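/- Let $q\ge 4$ and $n\ge 1$ be integers, and let $L_q$ be the set of rankings of the alternatives $[q]$, i.e. permutations $x$ of $[q]$, where $x(k)$ is the alternative ranked in the $k$-th position from the top; for $x\in L_q$ write $a \stackrel{x}{>} b$ if $x$ ranks $a$ above $b$. Let $f:L_q^n\to[q]$ be a neutral social choice function, i.e. $f(yx_1,\dots,yx_n)=y(f(x_1,\dots,x_n))$ for all $x\in L_q^n$ and $y\in L_q$, where $yx_i$ is the composition of permutations. Let $\mathrm{DICT}$ be the set of all functions $L_q^n\to[q]$ that depend only on a single coordinate, and suppose that $$\mathrm{Dist}(f,\mathrm{DICT})=\min_{g\in \mathrm{DICT}}\mathbf P\big(f(X)\ne g(X)\big)\ \ge\ \epsilon\ \ge\ 0,$$ where $X$ is uniformly distributed on $L_q^n$. Then $$\mathbf P\big(f\text{ is manipulable at }X\big)\ \ge\ \mathbf P\big(X\text{ is a 4-manipulation point of }f\big)\ \ge\ \frac{\epsilon^2}{10^4\,n^3\,q^{30}}.$$ Here $f$ is manipulable at $x\in L_q^n$ if there are $y\in L_q^n$ and $i\in[n]$ such that $x$ and $y$ differ only in the $i$-th coordinate and $f(y)\stackrel{x_i}{>}f(x)$;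 such a pair $(x,y)$ is called a manipulation pair. The point $x$ is a 4-manipulation point of $f$ if there is a manipulation pair $(x,y)$ such that $y$ is obtained from $x$ by permuting at most 4 adjacent alternatives in one of the coordinates of $x$. -/

import Mathlib

namespace SocialChoice

/-- A ranking of the alternatives `Fin q`, as a permutation: `x k` is the alternative ranked at
position `k` by `x`, position `0` being the top. -/
abbrev Ranking (q : ℕ) : Type := Equiv.Perm (Fin q)

/-- A profile of rankings, one for each of `n` voters. -/
abbrev Profile (n q : ℕ) : Type := Fin n → Ranking q

/-- A social choice function of `n` voters and `q` alternatives. -/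
abbrev SCF (n q : ℕ) : Type := Profile n q → Fin q

/-- `Prefers x a b`: the ranking `x` places `a` strictly above `b`. -/
def Prefers {q : ℕ} (x : Ranking q) (a b : Fin q) : Prop :=
  x.symm a < x.symm b

/-- Invariance under renaming the alternatives: `f (y x₁, …, y xₙ) = y (f (x₁, …, xₙ))`. -/
def IsNeutral {n q : ℕ} (f : SCF n q) : Prop :=
  ∀ (x : Profile n q) (y : Ranking q), y (f x) = f (fun i => y * x i)

/-- The profiles `x` and `y` only differ in the coordinate `i`. -/
def OnlyDiffersAt {n q : ℕ} (i : Fin n) (x y : Profile n q) : Prop :=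
  ∀ j, j ≠ i → x j = y j

/-- `(x, y)` is a manipulation pair for `f`: they only differ in the ranking of one voter, who
under the ranking in `x` strictly prefers `f y` to `f x`. -/
def IsManipulationPair {n q : ℕ} (f : SCF n q) (x y : Profile n q) : Prop :=
  ∃ i, OnlyDiffersAt i x y ∧ Prefers (x i) (f y) (f x)

/-- `x` is a manipulation point of `f`, i.e. `f` is manipulable at `x`. -/
def IsManipulationPoint {n q : ℕ} (f : SCF n q) (x : Profile n q) : Prop :=
  ∃ y, IsManipulationPair f x y

/-- `v` is obtained from `u` by permuting at most `r` adjacent alternatives: the two rankings agree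
at all positions outside a window of `r` consecutive positions. -/
def IsBlockReordering {q : ℕ} (r : ℕ) (u v : Ranking q) : Prop :=
  ∃ s : ℕ, ∀ k : Fin q, ¬ (s ≤ (k : ℕ) ∧ (k : ℕ) < s + r) → v k = u k

/-- `x` is an `r`-manipulation point of `f`. -/
def IsRManipulationPoint {n q : ℕ} (r : ℕ) (f : SCF n q) (x : Profile n q) : Prop :=
  ∃ y, IsManipulationPair f x y ∧
    ∃ i, OnlyDiffersAt i x y ∧ IsBlockReordering r (x i) (y i)

/-- The probability of `P X` for a uniformly random profile `X`: the fraction of the profiles that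
satisfy `P`. -/
noncomputable def prob {n q : ℕ} (P : Profile n q → Prop) : ℝ :=
  (Nat.card {x : Profile n q // P x} : ℝ) / (Nat.card (Profile n q) : ℝ)

/-- The distance between two social choice functions: the fraction of profiles on which they
differ. -/
noncomputable def dist {n q : ℕ} (f g : SCF n q) : ℝ :=
  prob fun x => f x ≠ g x

/-- The distance from a social choice function to a (nonempty) class of such functions; the infimum
is a minimum since there are finitely many functions. -/
noncomputable def distClass {n q : ℕ} (f : SCF n q) (G : Set (SCF n q)) : ℝ :=
  sInf (dist f '' G)

/-- The functions that only depend on the `i`-th coordinate. -/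
def DICTAt (n q : ℕ) (i : Fin n) : Set (SCF n q) :=
  {f | DependsOn f {i}}

/-- The dictator functions: those that only depend on one coordinate. -/
def DICT (n q : ℕ) : Set (SCF n q) :=
  ⋃ i : Fin n, DICTAt n q i

end SocialChoice

/-! Two disjoint pairs of alternatives {a, b} and {c, d}, which is where q ≥ 4 enters, are played
against each other in the hands of two different voters i and j. By neutrality, all ordered pairs of
distinct alternatives have equally many boundary profiles in a given direction. Since f is far from
functions of one voter, these are numerous in some direction other than any prescribed one
(`IsNeutral.exists_le_count_isBoundary`). So voter i often turns a into b, and voter j often turns c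
into d.

Let μ be the number of 4-manipulation points; everything below holds up to errors proportional to μ.
An exchange of adjacent alternatives changes the outcome only between these two, and in favour of
the voter (`outcome_change`). Hence a winner that is raised keeps winning, and a boundary profile is
a pair edge: the voter can decide between a and b by moving both to the top. Being a pair edge for
a, b survives every exchange except that of a and b (`IsPairEdge.of_agreeExcept`), so it is
essentially a function of how each voter orders a and b. These orders are independent of the orders
of c and d. Writing E for the pair edges of i and a, b, and F for those of j and c, d, the density
of E times that of F is therefore at most about the density of E ∩ F (`count_isPairEdge_mul_le`).
But E ∩ F is negligible: if i moves a, b and j moves c, d to the top, the outcome would have to be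
both a and c. This bounds the product of the two boundaries by a multiple of μ. -/

namespace SocialChoice

open Finset Function

/-! ### Counting in finite types, in place of probabilities -/

section Counting

variable {α β : Type*} [Fintype α] [Fintype β]

open Classical in
/-- The number of elements of a finite type with a given property. -/
noncomputable def count (P : α → Prop) : ℕ := (univ.filter P).card

lemma count_mono {P P' : α → Prop} (h : ∀ x, P x → P' x) : count P ≤ count P' := by
  classical
  exact card_le_card fun x hx => by
    simp only [mem_filter, mem_univ, true_and] at hx ⊢
    exact h x hx

lemma count_or (P P' : α → Prop) : count (fun x => P x ∨ P' x) ≤ count P + count P' := by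
  classical
  refine (card_le_card fun x hx => ?_).trans (card_union_le (univ.filter P) (univ.filter P'))
  simpa using hx

lemma count_exists {ι : Type*} [Fintype ι] (P : ι → α → Prop) :
    count (fun x => ∃ i, P i x) ≤ ∑ i, count (P i) := by
  classical
  unfold count
  refine (card_le_card fun x hx => ?_).trans (card_biUnion_le (s := univ))
  simp only [mem_filter, mem_univ, true_and, mem_biUnion] at hx ⊢
  exact hx

lemma count_exists_le {ι : Type*} [Fintype ι] (P : ι → α → Prop) {C : ℕ}
    (h : ∀ i, count (P i) ≤ C) : count (fun x => ∃ i, P i x) ≤ Fintype.card ι * C := by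
  refine (count_exists P).trans ((sum_le_sum fun i _ => h i).trans ?_)
  simp

/-- Serves as invariance of the uniform measure under a change of variables; an injection suffices
since only upper bounds are needed. -/
lemma count_comp {e : α → β} (he : Injective e) (P : β → Prop) :
    count (fun x => P (e x)) ≤ count P := by
  classical
  refine card_le_card_of_injOn e (fun x hx => ?_) he.injOn
  simpa using hx

lemma count_le_card (P : α → Prop) : count P ≤ Fintype.card α := by
  classical
  exact card_le_univ _

lemma count_prod (P : α → Prop) (P' : β → Prop) :
    count (fun p : α × β => P p.1 ∧ P' p.2) = count P * count P' := by
  classical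
  unfold count
  rw [← card_product]
  congr 1
  ext p
  simp

lemma count_fst (P : α → Prop) :
    count (fun p : α × β => P p.1) = count P * Fintype.card β := by
  classical
  have := count_prod P (fun _ : β => True)
  simpa [count] using this

lemma count_prod_eq_sum (P : α × β → Prop) : count P = ∑ r, count (fun x => P (x, r)) := by
  classical
  unfold count
  rw [← card_sigma]
  refine card_bij (fun (p : α × β) _ => (⟨p.2, p.1⟩ : Σ _ : β, α)) (fun x hx => ?_) ?_ ?_
  · simpa using hx
  · rintro ⟨x, y⟩ - ⟨x', y'⟩ - hxy
    simp only [Sigma.mk.injEq, heq_eq_eq] at hxy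
    simp [hxy.1, hxy.2]
  · rintro ⟨r, x⟩ h
    exact ⟨(x, r), by simpa using h, rfl⟩

lemma count_prod_le (P : α × β → Prop) {C : ℕ} (h : ∀ r, count (fun x => P (x, r)) ≤ C) :
    count P ≤ Fintype.card β * C := by
  rw [count_prod_eq_sum]
  refine (sum_le_sum fun r _ => h r).trans ?_
  simp

lemma nat_card_subtype_eq_count (P : α → Prop) : Nat.card {x // P x} = count P := by
  classical
  rw [Nat.card_eq_fintype_card, Fintype.card_subtype]
  unfold count
  congr

end Counting

/-! ### Rankings, adjacent exchanges, moving alternatives to the top -/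

section Rankings

variable {q : ℕ}

lemma not_prefers_self (x : Ranking q) (a : Fin q) : ¬ Prefers x a a := lt_irrefl _

lemma Prefers.asymm {x : Ranking q} {a b : Fin q} (h : Prefers x a b) : ¬ Prefers x b a :=
  lt_asymm h

lemma Prefers.trans {x : Ranking q} {a b c : Fin q} (h : Prefers x a b) (h' : Prefers x b c) :
    Prefers x a c :=
  lt_trans h h'

lemma prefers_or_prefers (x : Ranking q) {a b : Fin q} (h : a ≠ b) :
    Prefers x a b ∨ Prefers x b a :=
  lt_or_gt_of_ne fun h' => h (x.symm.injective h')

lemma prefers_swap_mul (x : Ranking q) {a b : Fin q} (h : a ≠ b) :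
    Prefers (Equiv.swap a b * x) a b ↔ ¬ Prefers x a b := by
  have : Prefers (Equiv.swap a b * x) a b ↔ Prefers x b a := by
    unfold Prefers
    simp [Equiv.Perm.mul_def]
  rw [this]
  exact ⟨Prefers.asymm, fun h' => (prefers_or_prefers x h).resolve_left h'⟩

lemma prefers_swap_mul_of_ne (x : Ranking q) {a b c d : Fin q} (hac : c ≠ a) (hbc : c ≠ b)
    (had : d ≠ a) (hbd : d ≠ b) :
    Prefers (Equiv.swap a b * x) c d ↔ Prefers x c d := by
  unfold Prefers
  simp [Equiv.Perm.mul_def, Equiv.swap_apply_of_ne_of_ne, *]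

/-- The rankings `x` and `y` order every pair of alternatives other than `{u, v}` in the same
way. -/
def AgreeExcept (u v : Fin q) (x y : Ranking q) : Prop :=
  ∀ g h, ¬ (g = u ∧ h = v) → ¬ (g = v ∧ h = u) → (Prefers x g h ↔ Prefers y g h)

lemma AgreeExcept.symm {u v : Fin q} {x y : Ranking q} (h : AgreeExcept u v x y) :
    AgreeExcept u v y x := fun g h' h₁ h₂ => (h g h' h₁ h₂).symm

lemma AgreeExcept.comm {u v : Fin q} {x y : Ranking q} (h : AgreeExcept u v x y) :
    AgreeExcept v u x y := fun g h' h₁ h₂ => h g h' h₂ h₁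

lemma agreeExcept_mul_swap (x : Ranking q) {p p' : Fin q} (hp : (p' : ℕ) = p + 1) :
    AgreeExcept (x p) (x p') x (x * Equiv.swap p p') := by
  intro g h h₁ h₂
  obtain ⟨i, rfl⟩ := x.surjective g
  obtain ⟨j, rfl⟩ := x.surjective h
  simp only [EmbeddingLike.apply_eq_iff_eq] at h₁ h₂
  unfold Prefers
  simp only [Equiv.Perm.mul_def, Equiv.symm_trans_apply, Equiv.symm_apply_apply, Equiv.symm_swap,
    Equiv.swap_apply_def]
  split_ifs <;> simp only [Fin.lt_def, Fin.ext_iff] at * <;> omega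

-- The order relation thus determines all positions, hence the ranking.
open Classical in
lemma card_prefers (x : Ranking q) (g : Fin q) :
    (univ.filter fun h => Prefers x h g).card = (x.symm g : ℕ) := by
  rw [← Fin.card_Iio (x.symm g)]
  refine card_bij (fun h _ => x.symm h) (fun h hh => ?_) (fun _ _ _ _ h => x.symm.injective h)
    fun i hi => ⟨x i, ?_, by simp⟩
  · rw [mem_filter] at hh
    simpa [Prefers] using hh.2
  · rw [mem_filter]
    simpa [Prefers] using hi

lemma AgreeExcept.symm_apply_eq {u v : Fin q} {x y : Ranking q} (h : AgreeExcept u v x y)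
    {g : Fin q} (hu : g ≠ u) (hv : g ≠ v) : x.symm g = y.symm g := by
  classical
  apply Fin.ext
  rw [← card_prefers, ← card_prefers]
  congr 1
  ext k
  simp [h k g (fun hh => hv hh.2) (fun hh => hu hh.2)]

/-- An alternative strictly between u and v in x would keep its order with both in y and force u
above v there. So u and v are adjacent, and nothing else moves. -/
lemma isBlockReordering_of_agreeExcept_of_prefers {u v : Fin q} {x y : Ranking q}
    (h : AgreeExcept u v x y) (hx : Prefers x u v) (hy : Prefers y v u) :
    IsBlockReordering 4 x y := by
  have hadj : (x.symm v : ℕ) = x.symm u + 1 := by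
    by_contra hne
    have hlt : (x.symm u : ℕ) < x.symm v := hx
    have hm : (x.symm u : ℕ) + 1 < q := by have := (x.symm v).2; omega
    set m : Fin q := ⟨(x.symm u : ℕ) + 1, hm⟩ with hmdef
    have hum : x.symm u < m := by simp [Fin.lt_def, hmdef]
    have hmv : m < x.symm v := by simp only [Fin.lt_def, hmdef]; omega
    have h1 : Prefers x u (x m) := by simpa [Prefers] using hum
    have h2 : Prefers x (x m) v := by simpa [Prefers] using hmv
    have hmu' : x m ≠ u := fun e => by rw [e] at h1; exact not_prefers_self _ _ h1
    have hmv' : x m ≠ v := fun e => by rw [e] at h2; exact not_prefers_self _ _ h2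
    have h1' := (h u (x m) (fun e => hmv' e.2) (fun e => hmu' e.2)).1 h1
    have h2' := (h (x m) v (fun e => hmu' e.1) (fun e => hmv' e.1)).1 h2
    exact (h1'.trans h2').asymm hy
  refine ⟨x.symm u, fun k hk => ?_⟩
  have hu : x k ≠ u := by rintro rfl; simp at hk
  have hv : x k ≠ v := by
    rintro rfl
    rw [Equiv.symm_apply_apply] at hadj
    omega
  have := h.symm_apply_eq hu hv
  rw [Equiv.symm_apply_apply] at this
  rw [this, Equiv.apply_symm_apply]
  rw [← this]

lemma eq_of_prefers_iff {x y : Ranking q} (h : ∀ g k, Prefers x g k ↔ Prefers y g k) : x = y := by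
  classical
  have : x.symm = y.symm := by
    ext g
    rw [← card_prefers, ← card_prefers]
    simp [h]
  rw [← Equiv.symm_symm x, this, Equiv.symm_symm]

lemma AgreeExcept.isBlockReordering {u v : Fin q} {x y : Ranking q} (h : AgreeExcept u v x y) :
    IsBlockReordering 4 x y := by
  by_cases huv : u = v
  · have : x = y := eq_of_prefers_iff fun g k => by
      by_cases hg : g = u ∧ k = v
      · obtain ⟨rfl, rfl⟩ := hg
        subst huv
        simp [not_prefers_self]
      · exact h g k hg (by rwa [← huv, huv, and_comm, and_comm, ← huv] at *)
    exact ⟨0, fun k _ => by rw [this]⟩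
  rcases prefers_or_prefers x huv with hx | hx <;> rcases prefers_or_prefers y huv with hy | hy
  · have : x = y := eq_of_prefers_iff fun g k => by
      by_cases h1 : g = u ∧ k = v
      · obtain ⟨rfl, rfl⟩ := h1; exact iff_of_true hx hy
      by_cases h2 : g = v ∧ k = u
      · obtain ⟨rfl, rfl⟩ := h2; exact iff_of_false hx.asymm hy.asymm
      exact h g k h1 h2
    exact ⟨0, fun k _ => by rw [this]⟩
  · exact isBlockReordering_of_agreeExcept_of_prefers h hx hy
  · exact isBlockReordering_of_agreeExcept_of_prefers h.comm hx hy
  · have : x = y := eq_of_prefers_iff fun g k => by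
      by_cases h1 : g = u ∧ k = v
      · obtain ⟨rfl, rfl⟩ := h1; exact iff_of_false hx.asymm hy.asymm
      by_cases h2 : g = v ∧ k = u
      · obtain ⟨rfl, rfl⟩ := h2; exact iff_of_true hx hy
      exact h g k h1 h2
    exact ⟨0, fun k _ => by rw [this]⟩

/-- The ranking `x` with the alternative `a` moved to the top. -/
def moveTop (a : Fin q) (x : Ranking q) : Ranking q :=
  x * (Fin.cycleRange (x.symm a)).symm

lemma cycleRange_lt_cycleRange (i j k : Fin q) :
    Fin.cycleRange i j < Fin.cycleRange i k ↔ (j = i ∧ k ≠ i) ∨ (j ≠ i ∧ k ≠ i ∧ j < k) := by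
  have : NeZero q := ⟨by rintro rfl; exact i.elim0⟩
  have key : ∀ j : Fin q, (Fin.cycleRange i j : ℕ) =
      if (j : ℕ) < i then (j : ℕ) + 1 else if (j : ℕ) = i then 0 else j := by
    intro j
    rcases lt_trichotomy j i with h | h | h
    · rw [Fin.coe_cycleRange_of_lt h, if_pos (Fin.lt_def.1 h)]
    · subst h
      simp
    · rw [Fin.cycleRange_of_gt h]
      simp only [Fin.lt_def] at h
      rw [if_neg (by omega), if_neg (by omega)]
  simp only [Fin.lt_def, Fin.ext_iff, key, ne_eq]
  split_ifs <;> omega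

lemma prefers_moveTop (a : Fin q) (x : Ranking q) (g h : Fin q) :
    Prefers (moveTop a x) g h ↔ (g = a ∧ h ≠ a) ∨ (g ≠ a ∧ h ≠ a ∧ Prefers x g h) := by
  have := cycleRange_lt_cycleRange (x.symm a) (x.symm g) (x.symm h)
  simp only [EmbeddingLike.apply_eq_iff_eq, ne_eq] at this
  unfold Prefers
  rw [← this]
  simp [moveTop, Equiv.Perm.mul_def]

/-- The ranking `x` with the alternatives `a` and `b` moved to the top, `a` above `b`. -/
def moveTopPair (a b : Fin q) (x : Ranking q) : Ranking q := moveTop a (moveTop b x)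

/-- The permutations of positions that turn a ranking `x` into `moveTopPair a b x`. -/
def topShift (s : Fin q × Fin q) : Equiv.Perm (Fin q) :=
  (Fin.cycleRange s.1).symm * (Fin.cycleRange s.2).symm

/-- Moving to the top is not injective, but it coincides pointwise with one of q² right
multiplications, which are; this is the source of the q² in the union bounds. -/
lemma exists_moveTopPair_eq (a b : Fin q) (x : Ranking q) :
    ∃ s, moveTopPair a b x = x * topShift s :=
  ⟨(_, _), mul_assoc _ _ _⟩

lemma not_prefers_moveTopPair (a b g : Fin q) (x : Ranking q) :
    ¬ Prefers (moveTopPair a b x) g a := by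
  simp [moveTopPair, prefers_moveTop]

lemma prefers_moveTopPair_self (a b g : Fin q) (x : Ranking q) (h : Prefers x a g) :
    Prefers (moveTopPair a b x) a g := by
  have : g ≠ a := fun e => not_prefers_self x a (e ▸ h)
  simp [moveTopPair, prefers_moveTop, this]

lemma prefers_moveTopPair_of_ne {a b c d : Fin q} (x : Ranking q) (hac : c ≠ a) (hbc : c ≠ b)
    (had : d ≠ a) (hbd : d ≠ b) : Prefers (moveTopPair a b x) c d ↔ Prefers x c d := by
  simp [moveTopPair, prefers_moveTop, *]

lemma AgreeExcept.moveTop {u v : Fin q} {x y : Ranking q} (h : AgreeExcept u v x y) (a : Fin q) :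
    AgreeExcept u v (moveTop a x) (moveTop a y) := by
  intro g k h₁ h₂
  rw [prefers_moveTop, prefers_moveTop, h g k h₁ h₂]

lemma AgreeExcept.moveTopPair {u v : Fin q} {x y : Ranking q} (h : AgreeExcept u v x y)
    (a b : Fin q) : AgreeExcept u v (moveTopPair a b x) (moveTopPair a b y) :=
  (h.moveTop b).moveTop a

lemma agreeExcept_moveTopPair (a b : Fin q) (x : Ranking q) :
    AgreeExcept a b (moveTopPair a b x) (moveTopPair b a x) := by
  intro g k h₁ h₂
  simp only [SocialChoice.moveTopPair, prefers_moveTop]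
  by_cases ha : g = a <;> by_cases hb : g = b <;> by_cases ha' : k = a <;> by_cases hb' : k = b <;>
    simp_all

end Rankings

/-! ### Factoring permutations into adjacent exchanges -/

section Descents

variable {q : ℕ}

lemma exists_descent {w : Equiv.Perm (Fin q)} (hw : w ≠ 1) :
    ∃ p p' : Fin q, (p' : ℕ) = p + 1 ∧ w p' < w p := by
  by_contra! hcon
  apply hw
  rcases q with _ | m
  · exact Subsingleton.elim _ _
  have hmono : StrictMono w := by
    rw [Fin.strictMono_iff_lt_succ]
    intro i
    refine lt_of_le_of_ne (hcon i.castSucc i.succ (by simp)) fun h => ?_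
    exact (Fin.castSucc_lt_succ (i := i)).ne (w.injective h)
  have := (hmono.range_inj strictMono_id).1 (by simp [w.surjective.range_eq])
  ext i
  simp [this]

/-- A measure of disorder of a permutation, which decreases when a descent is removed. -/
def disorder (w : Equiv.Perm (Fin q)) : ℕ := ∑ k : Fin q, (k : ℕ) * (q - w k)

lemma disorder_le (w : Equiv.Perm (Fin q)) : disorder w ≤ q ^ 3 := by
  refine (sum_le_card_nsmul univ _ (q * q) fun k _ => ?_).trans ?_
  · exact Nat.mul_le_mul k.2.le (Nat.sub_le _ _)
  · simp only [card_univ, Fintype.card_fin, smul_eq_mul]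
    exact le_of_eq (by ring)

lemma disorder_mul_swap_lt (w : Equiv.Perm (Fin q)) {p p' : Fin q} (hp : (p' : ℕ) = p + 1)
    (h : w p' < w p) : disorder (w * Equiv.swap p p') < disorder w := by
  have hne : p ≠ p' := fun e => by rw [e] at hp; omega
  have key : ((disorder w : ℕ) : ℤ) - disorder (w * Equiv.swap p p') = (w p : ℤ) - w p' := by
    unfold disorder
    rw [Nat.cast_sum, Nat.cast_sum, ← sum_sub_distrib, Fintype.sum_eq_add p p' hne]
    · simp only [Equiv.Perm.mul_apply, Equiv.swap_apply_left, Equiv.swap_apply_right,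
        Nat.cast_mul]
      rw [Nat.cast_sub (w p).2.le, Nat.cast_sub (w p').2.le, hp]
      push_cast
      ring
    · rintro x ⟨h1, h2⟩
      rw [Equiv.Perm.mul_apply, Equiv.swap_apply_of_ne_of_ne h1 h2, sub_self]
  have : (w p' : ℕ) < w p := h
  omega

end Descents

/-! ### Outcomes along paths without manipulation -/

section Profiles

variable {n q : ℕ}

/-- The profile `z` with the ranking at coordinate `k` composed on the right with `w`. -/
def mulAt (k : Fin n) (w : Equiv.Perm (Fin q)) (z : Profile n q) : Profile n q :=
  update z k (z k * w)

lemma mulAt_mul (k : Fin n) (w w' : Equiv.Perm (Fin q)) (z : Profile n q) :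
    mulAt k (w * w') z = mulAt k w' (mulAt k w z) := by
  simp [mulAt, mul_assoc]

lemma mulAt_one (k : Fin n) (z : Profile n q) : mulAt k 1 z = z := by
  simp [mulAt]

lemma mulAt_injective (k : Fin n) (w : Equiv.Perm (Fin q)) :
    Injective (mulAt k w : Profile n q → Profile n q) :=
  LeftInverse.injective (g := mulAt k w⁻¹) fun z => by
    rw [← mulAt_mul, mul_inv_cancel, mulAt_one]

lemma isRManipulationPoint_of_prefers {f : SCF n q} {z : Profile n q} {k : Fin n} {y : Ranking q}
    (hb : IsBlockReordering 4 (z k) y) (h : Prefers (z k) (f (update z k y)) (f z)) :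
    IsRManipulationPoint 4 f z := by
  have hd : OnlyDiffersAt k z (update z k y) := fun j hj => by simp [hj]
  exact ⟨update z k y, ⟨k, hd, h⟩, k, hd, by simpa using hb⟩

/-- Between two profiles that are no manipulation points and differ by one exchange of adjacent
alternatives, the outcome can only change between the two exchanged alternatives, and in favour of
the voter. -/
lemma outcome_change {f : SCF n q} {z : Profile n q} {k : Fin n} {y : Ranking q} {u v : Fin q}
    (h : AgreeExcept u v (z k) y) (hz : ¬ IsRManipulationPoint 4 f z)
    (hz' : ¬ IsRManipulationPoint 4 f (update z k y)) (hne : f (update z k y) ≠ f z) :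
    ((f z = u ∧ f (update z k y) = v) ∨ (f z = v ∧ f (update z k y) = u)) ∧
      Prefers (z k) (f z) (f (update z k y)) ∧ Prefers y (f (update z k y)) (f z) := by
  have h1 : Prefers (z k) (f z) (f (update z k y)) :=
    (prefers_or_prefers _ hne).resolve_left fun h' =>
      hz (isRManipulationPoint_of_prefers h.isBlockReordering h')
  have h2 : Prefers y (f (update z k y)) (f z) :=
    (prefers_or_prefers _ hne).resolve_right fun h' => hz' <|
      isRManipulationPoint_of_prefers (k := k) (y := z k)
        (by simpa using h.symm.isBlockReordering) (by simpa using h')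
  refine ⟨?_, h1, h2⟩
  by_contra hcon
  rw [not_or] at hcon
  exact h2.asymm ((h _ _ hcon.1 hcon.2).1 h1)

/-- A change of outcome would have to improve on a in the ranking y, where a is already on top. -/
lemma outcome_eq_of_top {f : SCF n q} {z : Profile n q} {k : Fin n} {x y : Ranking q}
    {u v a : Fin q} (h : AgreeExcept u v x y) (hx : ¬ IsRManipulationPoint 4 f (update z k x))
    (hy : ¬ IsRManipulationPoint 4 f (update z k y)) (ha : f (update z k x) = a)
    (htop : ∀ g, ¬ Prefers y g a) : f (update z k y) = a := by
  by_contra hne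
  have := outcome_change (z := update z k x) (k := k) (y := y) (by simpa using h) hx
    (by simpa using hy) (by simpa [ha] using hne)
  simp only [update_idem, ha] at this
  exact htop _ this.2.2

/-- Voter `i` can choose between the outcomes `a` and `b` by moving both to the top. -/
def IsPairEdge (f : SCF n q) (i : Fin n) (a b : Fin q) (z : Profile n q) : Prop :=
  f (update z i (moveTopPair a b (z i))) = a ∧ f (update z i (moveTopPair b a (z i))) = b

/-- Being a pair edge for `a` and `b` is preserved by exchanges of adjacent alternatives other than
`a` and `b`, in the absence of manipulation points. -/
lemma IsPairEdge.of_agreeExcept {f : SCF n q} {i k : Fin n} {a b u v : Fin q} {z : Profile n q}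
    {y : Ranking q} (hab : a ≠ b) (h : AgreeExcept u v (z k) y) (huv : ¬ (u = a ∧ v = b))
    (hvu : ¬ (u = b ∧ v = a))
    (h₁ : ¬ IsRManipulationPoint 4 f (update z i (moveTopPair a b (z i))))
    (h₂ : ¬ IsRManipulationPoint 4 f (update z i (moveTopPair b a (z i))))
    (h₃ : ¬ IsRManipulationPoint 4 f
      (update (update z k y) i (moveTopPair a b (update z k y i))))
    (h₄ : ¬ IsRManipulationPoint 4 f
      (update (update z k y) i (moveTopPair b a (update z k y i))))
    (hE : IsPairEdge f i a b z) : IsPairEdge f i a b (update z k y) := by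
  unfold IsPairEdge at hE ⊢
  by_cases hki : k = i
  · subst hki
    simp only [update_idem, update_self] at h₃ h₄ ⊢
    exact ⟨outcome_eq_of_top (h.moveTopPair a b) h₁ h₃ hE.1 fun g =>
        not_prefers_moveTopPair _ _ _ _,
      outcome_eq_of_top (h.moveTopPair b a) h₂ h₄ hE.2 fun g => not_prefers_moveTopPair _ _ _ _⟩
  · have hik : i ≠ k := Ne.symm hki
    simp only [update_of_ne hik] at h₃ h₄ ⊢
    have hc : ∀ r : Ranking q, update (update z k y) i r = update (update z i r) k y := fun r =>
      update_comm hki y r z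
    rw [hc] at h₃ h₄
    rw [hc, hc]
    set Z := update z i (moveTopPair a b (z i)) with hZ
    set Z' := update z i (moveTopPair b a (z i)) with hZ'
    have hW' : update (update Z k y) i (moveTopPair b a (z i)) = update Z' k y := by
      rw [hZ, hZ', ← hc, update_idem, hc]
    have s1 := outcome_change (z := Z) (k := k) (y := y) (by simpa [hZ, hki] using h) h₁ h₃
    have s2 := outcome_change (z := Z') (k := k) (y := y) (by simpa [hZ', hki] using h) h₂ h₄
    have s3 := outcome_change (z := update Z k y) (k := i) (y := moveTopPair b a (z i))
      (u := a) (v := b) (by simpa [hZ, hik] using agreeExcept_moveTopPair a b (z i)) h₃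
      (by rwa [hW'])
    rw [hW'] at s3
    rw [hE.1] at s1
    rw [hE.2] at s2
    have s1' := fun hne => (s1 hne).1
    have s2' := fun hne => (s2 hne).1
    have s3' := fun hne => (s3 hne).1
    clear s1 s2 s3
    -- If the first outcome leaves a, it lands outside {a, b}. The two outcomes must then agree,
    -- since voter i can only switch between a and b; so the second leaves b, which forces {u, v} =
    -- {a, b}. If only the second leaves b, it must become a, with the same contradiction.
    grind

/-- Counting changes of `g` along a path of exchanges of adjacent alternatives that does not
exchange `a` and `b`. -/
lemma count_ne_mulAt_le {γ : Type*} (g : Profile n q → γ) (k : Fin n) (a b : Fin q) {N : ℕ}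
    (hN : ∀ p p' : Fin q, (p' : ℕ) = p + 1 → count (fun z : Profile n q =>
      ¬ (z k p = a ∧ z k p' = b) ∧ ¬ (z k p = b ∧ z k p' = a) ∧
        g (mulAt k (Equiv.swap p p') z) ≠ g z) ≤ N) (w : Equiv.Perm (Fin q)) :
    count (fun z => (Prefers (z k * w) a b ↔ Prefers (z k) a b) ∧ g (mulAt k w z) ≠ g z) ≤
      disorder w * N := by
  induction hd : disorder w using Nat.strong_induction_on generalizing w with
  | _ d ih =>
  by_cases hw : w = 1
  · subst hw
    simp [mulAt_one, count]
  obtain ⟨p, p', hp, hlt⟩ := exists_descent hw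
  have hdis := disorder_mul_swap_lt w hp hlt
  set w' := w * Equiv.swap p p' with hw'
  have hww : w = w' * Equiv.swap p p' := by simp [hw', mul_assoc]
  have h1 := ih (disorder w') (hd ▸ hdis) w' rfl
  have h2 := count_comp (mulAt_injective k w') _ |>.trans (hN p p' hp)
  refine (count_mono fun z hz => ?_).trans ((count_or _ _).trans (Nat.add_le_add h1 h2)) |>.trans ?_
  · have hne : p ≠ p' := fun e => by rw [e] at hp; omega
    have hagree := agreeExcept_mul_swap (z k * w') hp
    rw [mul_assoc, ← hww] at hagree
    have e1 : (z k * w') p = z k (w p') := by simp [hw']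
    have e2 : (z k * w') p' = z k (w p) := by simp [hw']
    have pz : Prefers (z k) (z k (w p')) (z k (w p)) := by simpa [Prefers] using hlt
    have pw : Prefers (z k * w) (z k (w p)) (z k (w p')) := by
      simp [Prefers, Equiv.Perm.mul_def, Fin.lt_def, hp]
    -- Undoing a descent of w restores the original order of the exchanged pair. As a and b are
    -- ordered alike at both ends of the path, they are not that pair.
    have hn1 : ¬ ((z k * w') p = a ∧ (z k * w') p' = b) := by
      rw [e1, e2]
      rintro ⟨rfl, rfl⟩
      exact pw.asymm (hz.1.2 pz)
    have hn2 : ¬ ((z k * w') p = b ∧ (z k * w') p' = a) := by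
      rw [e1, e2]
      rintro ⟨rfl, rfl⟩
      exact pz.asymm (hz.1.1 pw)
    by_cases hg : g (mulAt k w' z) = g z
    · right
      refine ⟨by simpa [mulAt] using hn1, by simpa [mulAt] using hn2, ?_⟩
      rw [← mulAt_mul, ← hww, hg]
      exact hz.2
    · left
      refine ⟨?_, hg⟩
      rw [← hz.1]
      exact hagree a b (fun h => hn1 ⟨h.1.symm, h.2.symm⟩) (fun h => hn2 ⟨h.2.symm, h.1.symm⟩)
  · rw [← Nat.succ_mul]
    exact Nat.mul_le_mul_right _ (hd ▸ hdis)

/-- An alternative that wins keeps winning when it is raised, up to few profiles if there are few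
manipulation points. -/
lemma count_mulAt_raise_le (f : SCF n q) (k : Fin n) (a : Fin q) (w : Equiv.Perm (Fin q)) :
    count (fun z => (∀ g, Prefers (z k) a g → Prefers (z k * w) a g) ∧ f z = a ∧
      f (mulAt k w z) ≠ a) ≤ disorder w * (2 * count (IsRManipulationPoint 4 f)) := by
  induction hd : disorder w using Nat.strong_induction_on generalizing w with
  | _ d ih =>
  by_cases hw : w = 1
  · subst hw
    simp [mulAt_one, count]
  obtain ⟨p, p', hp, hlt⟩ := exists_descent hw
  have hdis := disorder_mul_swap_lt w hp hlt
  set w' := w * Equiv.swap p p' with hw'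
  have hww : w = w' * Equiv.swap p p' := by simp [hw', mul_assoc]
  have h1 := ih (disorder w') (hd ▸ hdis) w' rfl
  have h2 := count_comp (mulAt_injective k w') (IsRManipulationPoint 4 f)
  have h3 := count_comp (mulAt_injective k w) (IsRManipulationPoint 4 f)
  refine (count_mono fun z hz => ?_).trans ((count_or _ _).trans (Nat.add_le_add h1
    ((count_or _ _).trans (Nat.add_le_add h2 h3)))) |>.trans ?_
  · obtain ⟨hz, hfa, hfw⟩ := hz
    have hagree := agreeExcept_mul_swap (z k * w') hp
    rw [mul_assoc, ← hww] at hagree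
    have e1 : (z k * w') p = z k (w p') := by simp [hw']
    have e2 : (z k * w') p' = z k (w p) := by simp [hw']
    have pz : Prefers (z k) (z k (w p')) (z k (w p)) := by simpa [Prefers] using hlt
    have pw : Prefers (z k * w) (z k (w p)) (z k (w p')) := by
      simp [Prefers, Equiv.Perm.mul_def, Fin.lt_def, hp]
    have pw' : Prefers (z k * w') (z k (w p')) (z k (w p)) := by
      rw [← e1, ← e2]
      simp [Prefers, Equiv.Perm.mul_def, Fin.lt_def, hp]
    rw [e1, e2] at hagree
    by_cases hfw' : f (mulAt k w' z) = a
    · right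
      by_contra hcon
      rw [not_or] at hcon
      have hupd : mulAt k w z = update (mulAt k w' z) k (z k * w) := by simp [mulAt]
      rw [hupd] at hcon hfw
      have := outcome_change (z := mulAt k w' z) (k := k) (y := z k * w)
        (by simpa [mulAt] using hagree) hcon.1 hcon.2 (by rwa [hfw'])
      rw [hfw'] at this
      -- In the first case the exchange lowers a below an alternative it originally beat, against
      -- the hypothesis on w. In the second it raises a, and the voter would lose by it.
      obtain ⟨hpair | hpair, h1, h2⟩ := this
      · rw [hpair.2] at h2
        rw [← hpair.1] at pz
        exact h2.asymm (hz _ pz)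
      · rw [hpair.2, hpair.1] at h1
        simp only [mulAt, update_self] at h1
        exact h1.asymm pw'
    · left
      refine ⟨fun g hg => ?_, hfa, hfw'⟩
      refine (hagree a g ?_ ?_).2 (hz g hg)
      · rintro ⟨rfl, rfl⟩
        exact pw.asymm (hz _ hg)
      · rintro ⟨rfl, rfl⟩
        exact pz.asymm hg
  · rw [← two_mul, ← Nat.succ_mul]
    exact Nat.mul_le_mul_right _ (hd ▸ hdis)

end Profiles

/-! ### Resampling a profile while keeping the order of two alternatives -/

section Resampling

variable {n q : ℕ}

open Classical in
/-- The ranking `r`, with `a` and `b` exchanged if necessary for them to be ordered as in `x`. -/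
noncomputable def matchOrder (a b : Fin q) (x r : Ranking q) : Ranking q :=
  if (Prefers x a b ↔ Prefers r a b) then r else Equiv.swap a b * r

lemma prefers_matchOrder (a b : Fin q) (x r : Ranking q) :
    Prefers (matchOrder a b x r) a b ↔ Prefers x a b := by
  unfold matchOrder
  split_ifs with h
  · exact h.symm
  · by_cases hab : a = b
    · subst hab
      simp [not_prefers_self]
    · rw [prefers_swap_mul _ hab]
      tauto

/-- Swapping two rankings up to the order of a and b is an involution, so it preserves the uniform
distribution on pairs. -/
lemma matchOrder_matchOrder (a b : Fin q) (x r : Ranking q) :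
    matchOrder a b (matchOrder a b x r) (matchOrder a b r x) = x := by
  have h1 := prefers_matchOrder a b x r
  have h2 := prefers_matchOrder a b r x
  by_cases h : Prefers x a b ↔ Prefers r a b
  · rw [matchOrder, if_pos (by rw [h1, h2, h]), matchOrder, if_pos h.symm]
  · rw [matchOrder, if_neg (by rw [h1, h2]; exact h), matchOrder, if_neg fun h' => h h'.symm]
    simp [← mul_assoc]

lemma matchOrder_self (a : Fin q) (x r : Ranking q) : matchOrder a a x r = r := by
  simp [matchOrder, not_prefers_self]

lemma matchOrder_comm {a b c d : Fin q} (hac : c ≠ a) (hbc : c ≠ b) (had : d ≠ a) (hbd : d ≠ b)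
    (x y r : Ranking q) :
    matchOrder a b x (matchOrder c d y r) = matchOrder c d y (matchOrder a b x r) := by
  have h1 : ∀ r : Ranking q, Prefers (Equiv.swap a b * r) c d ↔ Prefers r c d := fun r =>
    prefers_swap_mul_of_ne r hac hbc had hbd
  have h2 : ∀ r : Ranking q, Prefers (Equiv.swap c d * r) a b ↔ Prefers r a b := fun r =>
    prefers_swap_mul_of_ne r hac.symm had.symm hbc.symm hbd.symm
  have h3 : Equiv.swap a b * (Equiv.swap c d * r) = Equiv.swap c d * (Equiv.swap a b * r) := by
    rw [← mul_assoc, ← mul_assoc]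
    congr 1
    ext z
    simp only [Equiv.Perm.mul_apply, Equiv.swap_apply_def]
    split_ifs <;> simp_all
  by_cases hab : Prefers x a b ↔ Prefers r a b <;> by_cases hcd : Prefers y c d ↔ Prefers r c d
  · rw [matchOrder, matchOrder, if_pos hcd, if_pos hab, matchOrder, matchOrder, if_pos hab,
      if_pos hcd]
  · rw [matchOrder, matchOrder, if_neg hcd, if_pos (by rwa [h2]), matchOrder, matchOrder,
      if_pos hab, if_neg hcd]
  · rw [matchOrder, matchOrder, if_pos hcd, if_neg hab, matchOrder, matchOrder, if_neg hab,
      if_pos (by rwa [h1])]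
  · rw [matchOrder, matchOrder, if_neg hcd, if_neg (by rwa [h2]), matchOrder, matchOrder,
      if_neg hab, if_neg (by rwa [h1]), h3]

open Classical in
/-- The profile `x`, where the coordinates in `S` are resampled from `r`, but keep their order of
`a` and `b`. -/
noncomputable def resample (a b : Fin q) (S : Finset (Fin n)) (x r : Profile n q) : Profile n q :=
  fun k => if k ∈ S then matchOrder a b (x k) (r k) else x k

/-- The exchange of coordinates in `S` between two profiles, up to the order of `a` and `b`. -/
noncomputable def exchange (a b : Fin q) (S : Finset (Fin n)) (p : Profile n q × Profile n q) :
    Profile n q × Profile n q :=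
  (resample a b S p.1 p.2, fun k => if k ∈ S then matchOrder a b (p.2 k) (p.1 k) else p.2 k)

lemma exchange_injective (a b : Fin q) (S : Finset (Fin n)) : Injective (exchange a b S) := by
  refine Involutive.injective fun p => ?_
  refine Prod.ext (funext fun k => ?_) (funext fun k => ?_) <;>
    by_cases hk : k ∈ S <;> simp [exchange, resample, hk, matchOrder_matchOrder]

/-- The new ranking is r or its image under the transposition of a and b. In either case it is the
old one times a permutation w that runs bijectively with r, so the path bound for fixed w can be
averaged; the factor 2 counts the cases. -/
lemma count_ne_update_matchOrder_le {γ : Type*} (g : Profile n q → γ) (k : Fin n) (a b : Fin q)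
    {N : ℕ} (hN : ∀ p p' : Fin q, (p' : ℕ) = p + 1 → count (fun z : Profile n q =>
      ¬ (z k p = a ∧ z k p' = b) ∧ ¬ (z k p = b ∧ z k p' = a) ∧
        g (mulAt k (Equiv.swap p p') z) ≠ g z) ≤ N) :
    count (fun p : Profile n q × Profile n q =>
      g (update p.1 k (matchOrder a b (p.1 k) (p.2 k))) ≠ g p.1) ≤
      2 * (Fintype.card (Profile n q) * (q ^ 3 * N)) := by
  set P : Profile n q × Profile n q → Prop := fun p =>
    (Prefers (p.1 k * p.2 k) a b ↔ Prefers (p.1 k) a b) ∧ g (mulAt k (p.2 k) p.1) ≠ g p.1 with hP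
  have hcount : count P ≤ Fintype.card (Profile n q) * (q ^ 3 * N) :=
    count_prod_le _ fun r => (count_ne_mulAt_le g k a b hN (r k)).trans
      (Nat.mul_le_mul_right _ (disorder_le _))
  -- Substitutes w = x⁻¹ τ r, so that x w = τ r, with τ = 1 or τ the transposition of a and b.
  have inj : ∀ τ : Profile n q, Injective fun p : Profile n q × Profile n q =>
      (p.1, p.1⁻¹ * τ * p.2) := by
    rintro τ ⟨x, r⟩ ⟨x', r'⟩ h
    simp only [Prod.mk.injEq] at h
    obtain ⟨rfl, h⟩ := h
    rw [mul_right_inj] at h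
    rw [h]
  have h1 := (count_comp (inj 1) P).trans hcount
  have h2 := (count_comp (inj fun _ => Equiv.swap a b) P).trans hcount
  rw [two_mul]
  refine (count_mono fun p hp => ?_).trans ((count_or _ _).trans (Nat.add_le_add h1 h2))
  have hm := prefers_matchOrder a b (p.1 k) (p.2 k)
  by_cases h : Prefers (p.1 k) a b ↔ Prefers (p.2 k) a b
  · left
    rw [matchOrder, if_pos h] at hm hp
    simp only [hP, mulAt, Pi.mul_apply, Pi.inv_apply, mul_one, mul_inv_cancel_left]
    exact ⟨hm, hp⟩
  · right
    rw [matchOrder, if_neg h] at hm hp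
    simp only [hP, mulAt, Pi.mul_apply, Pi.inv_apply, mul_assoc, mul_inv_cancel_left]
    exact ⟨hm, hp⟩

lemma count_ne_resample_le {γ : Type*} (g : Profile n q → γ) (a b : Fin q) {N : ℕ}
    (S : Finset (Fin n))
    (hN : ∀ k ∈ S, ∀ p p' : Fin q, (p' : ℕ) = p + 1 → count (fun z : Profile n q =>
      ¬ (z k p = a ∧ z k p' = b) ∧ ¬ (z k p = b ∧ z k p' = a) ∧
        g (mulAt k (Equiv.swap p p') z) ≠ g z) ≤ N) :
    count (fun p : Profile n q × Profile n q => g (resample a b S p.1 p.2) ≠ g p.1) ≤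
      S.card * (2 * (Fintype.card (Profile n q) * (q ^ 3 * N))) := by
  induction S using Finset.induction_on with
  | empty =>
    have : ∀ x r : Profile n q, resample a b ∅ x r = x := fun x r => by
      funext k
      simp [resample]
    simp [this, count]
  | insert k S hk ih =>
    have h1 := ih fun j hj => hN j (mem_insert_of_mem hj)
    have h2 := (count_comp (exchange_injective a b S) _).trans
      (count_ne_update_matchOrder_le g k a b (hN k (mem_insert_self k S)))
    rw [card_insert_of_notMem hk, Nat.succ_mul]
    refine (count_mono fun p hp => ?_).trans ((count_or _ _).trans (Nat.add_le_add h1 h2))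
    by_cases hg : g (resample a b S p.1 p.2) = g p.1
    · right
      -- Hybrid argument: after exchanging the coordinates in S, the pair is still uniform and
      -- coordinate k of both members is untouched, so the bound for one coordinate applies.
      have : resample a b (insert k S) p.1 p.2 = update (exchange a b S p).1 k
          (matchOrder a b ((exchange a b S p).1 k) ((exchange a b S p).2 k)) := by
        funext j
        by_cases hj : j = k
        · subst hj
          simp [exchange, resample, hk]
        · simp [exchange, resample, hj]
      rw [← this]
      simpa [exchange, hg] using hp
    · exact Or.inl hg

end Resampling

/-! ### Pair edges and boundaries -/

section Boundaries

variable {n q : ℕ}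

lemma count_update_moveTopPair_le (P : Profile n q → Prop) (i : Fin n) (a b : Fin q) :
    count (fun z => P (update z i (moveTopPair a b (z i)))) ≤ q ^ 2 * count P := by
  have := count_exists_le (fun (s : Fin q × Fin q) z => P (mulAt i (topShift s) z))
    fun s => count_comp (mulAt_injective i (topShift s)) P
  refine (count_mono fun z hz => ?_).trans (this.trans (le_of_eq (by simp [sq])))
  obtain ⟨s, hs⟩ := exists_moveTopPair_eq a b (z i)
  exact ⟨s, by rwa [hs] at hz⟩

/-- The 4 counts the profiles that must not be manipulation points: before and after the exchange,
with a or b on top. -/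
lemma count_isPairEdge_mulAt_swap_le (f : SCF n q) (i k : Fin n) {a b : Fin q} (hab : a ≠ b)
    {p p' : Fin q} (hp : (p' : ℕ) = p + 1) :
    count (fun z : Profile n q => ¬ (z k p = a ∧ z k p' = b) ∧ ¬ (z k p = b ∧ z k p' = a) ∧
      IsPairEdge f i a b (mulAt k (Equiv.swap p p') z) ≠ IsPairEdge f i a b z) ≤
      4 * (q ^ 2 * count (IsRManipulationPoint 4 f)) := by
  have h1 := count_update_moveTopPair_le (IsRManipulationPoint 4 f) i a b
  have h2 := count_update_moveTopPair_le (IsRManipulationPoint 4 f) i b a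
  have h3 := (count_comp (mulAt_injective k (Equiv.swap p p')) _).trans h1
  have h4 := (count_comp (mulAt_injective k (Equiv.swap p p')) _).trans h2
  refine (count_mono fun z hz => ?_).trans ((count_or _ _).trans (Nat.add_le_add h1
    ((count_or _ _).trans (Nat.add_le_add h2 ((count_or _ _).trans (Nat.add_le_add h3 h4))))))
    |>.trans (le_of_eq (by ring))
  obtain ⟨hn1, hn2, hne⟩ := hz
  by_contra hcon
  rw [not_or, not_or, not_or] at hcon
  obtain ⟨m1, m2, m3, m4⟩ := hcon
  have hagree := agreeExcept_mul_swap (z k) hp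
  refine hne (propext ⟨fun hE => ?_, fun hE => hE.of_agreeExcept hab hagree hn1 hn2 m1 m2 m3 m4⟩)
  have hz : z = update (mulAt k (Equiv.swap p p') z) k (z k) := by simp [mulAt]
  rw [hz] at m1 m2 ⊢
  exact hE.of_agreeExcept hab (by simpa [mulAt] using hagree.symm) hn1 hn2 m3 m4 m1 m2

lemma count_isPairEdge_update_moveTopPair_le (f : SCF n q) (i j : Fin n) {a b c d : Fin q}
    (hab : a ≠ b) (hac : a ≠ c) (hbc : b ≠ c) (had : a ≠ d) (hbd : b ≠ d) :
    count (fun z : Profile n q => IsPairEdge f i a b (update z j (moveTopPair c d (z j))) ≠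
      IsPairEdge f i a b z) ≤
      q ^ 2 * (q ^ 3 * (4 * (q ^ 2 * count (IsRManipulationPoint 4 f)))) := by
  have := count_exists_le (fun (s : Fin q × Fin q) (z : Profile n q) =>
      (Prefers (z j * topShift s) a b ↔ Prefers (z j) a b) ∧
        IsPairEdge f i a b (mulAt j (topShift s) z) ≠ IsPairEdge f i a b z)
    fun s => (count_ne_mulAt_le (IsPairEdge f i a b) j a b (fun p p' hp =>
      count_isPairEdge_mulAt_swap_le f i j hab hp) (topShift s)).trans
        (Nat.mul_le_mul_right _ (disorder_le _))
  refine (count_mono fun z hz => ?_).trans (this.trans (le_of_eq (by simp [sq])))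
  obtain ⟨s, hs⟩ := exists_moveTopPair_eq c d (z j)
  have := prefers_moveTopPair_of_ne (z j) hac had hbc hbd
  rw [hs] at this hz
  exact ⟨s, this, hz⟩

/-- Pair edges in different directions for disjoint pairs of alternatives exclude each other, up to
few profiles if there are few manipulation points. -/
lemma count_isPairEdge_and_isPairEdge_le (f : SCF n q) {i j : Fin n} (hij : i ≠ j)
    {a b c d : Fin q} (hab : a ≠ b) (hcd : c ≠ d) (hac : a ≠ c) (hbc : b ≠ c) (had : a ≠ d)
    (hbd : b ≠ d) :
    count (fun z => IsPairEdge f i a b z ∧ IsPairEdge f j c d z) ≤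
      8 * q ^ 7 * count (IsRManipulationPoint 4 f) := by
  have h1 := count_isPairEdge_update_moveTopPair_le f i j hab hac hbc had hbd
  have h2 := count_isPairEdge_update_moveTopPair_le f j i hcd hac.symm had.symm hbc.symm hbd.symm
  refine (count_mono fun z hz => ?_).trans ((count_or _ _).trans (Nat.add_le_add h1 h2))
    |>.trans (le_of_eq (by ring))
  by_contra hcon
  rw [not_or, not_not, not_not] at hcon
  -- Both pair edges survive the other voter's move, so one and the same profile has outcomes a and
  -- c.
  have e1 := (hcon.1.symm ▸ hz.1 : IsPairEdge f i a b (update z j (moveTopPair c d (z j)))).1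
  have e2 := (hcon.2.symm ▸ hz.2 : IsPairEdge f j c d (update z i (moveTopPair a b (z i)))).1
  rw [update_of_ne hij] at e1
  rw [update_of_ne hij.symm] at e2
  rw [update_comm hij, e1] at e2
  exact hac e2

/-- An exchange of alternatives at adjacent positions by voter `k` changes the outcome from `a` to
`b`. -/
def IsBoundary (f : SCF n q) (k : Fin n) (a b : Fin q) (z : Profile n q) : Prop :=
  ∃ s : Fin q × Fin q, (s.2 : ℕ) = s.1 + 1 ∧ f z = a ∧ f (mulAt k (Equiv.swap s.1 s.2) z) = b

lemma count_ne_update_moveTopPair_le (f : SCF n q) (i : Fin n) (a b : Fin q) :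
    count (fun z => f z = a ∧ f (update z i (moveTopPair a b (z i))) ≠ a) ≤
      2 * q ^ 5 * count (IsRManipulationPoint 4 f) := by
  have := count_exists_le (fun (s : Fin q × Fin q) (z : Profile n q) =>
      (∀ g, Prefers (z i) a g → Prefers (z i * topShift s) a g) ∧ f z = a ∧
        f (mulAt i (topShift s) z) ≠ a)
    fun s => (count_mulAt_raise_le f i a (topShift s)).trans
      (Nat.mul_le_mul_right _ (disorder_le _))
  refine (count_mono fun z hz => ?_).trans (this.trans (le_of_eq ?_))
  · obtain ⟨s, hs⟩ := exists_moveTopPair_eq a b (z i)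
    have := fun g => prefers_moveTopPair_self a b g (z i)
    rw [hs] at this hz
    exact ⟨s, this, hz⟩
  · simp only [Fintype.card_prod, Fintype.card_fin]
    ring

/-- Raising a from z keeps a winning, and raising b after the exchange keeps b winning. With b, a
moved to the top, the profiles before and after the exchange differ in at most one adjacent pair and
have b on top, so b also wins before it. -/
lemma count_isBoundary_and_not_isPairEdge_le (f : SCF n q) (i : Fin n) (a b : Fin q) :
    count (fun z => IsBoundary f i a b z ∧ ¬ IsPairEdge f i a b z) ≤
      6 * q ^ 7 * count (IsRManipulationPoint 4 f) := by
  have hq : 1 ≤ q := a.pos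
  have h1 := count_ne_update_moveTopPair_le f i a b
  have h2 := count_update_moveTopPair_le (IsRManipulationPoint 4 f) i b a
  have h3 := count_exists_le (fun (s : Fin q × Fin q) (z : Profile n q) =>
      (fun y => (f y = b ∧ f (update y i (moveTopPair b a (y i))) ≠ b) ∨
        IsRManipulationPoint 4 f (update y i (moveTopPair b a (y i))))
      (mulAt i (Equiv.swap s.1 s.2) z))
    fun s => (count_comp (mulAt_injective i (Equiv.swap s.1 s.2)) _).trans <|
      (count_or _ _).trans (Nat.add_le_add (count_ne_update_moveTopPair_le f i b a) h2)
  refine (count_mono fun z hz => ?_).trans ((count_or _ _).trans (Nat.add_le_add h1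
    ((count_or _ _).trans (Nat.add_le_add h2 h3)))) |>.trans ?_
  · obtain ⟨⟨s, hs, hfa, hfb⟩, hE⟩ := hz
    rw [IsPairEdge, not_and] at hE
    by_cases ha : f (update z i (moveTopPair a b (z i))) = a
    · right
      by_contra hcon
      rw [not_or, not_exists] at hcon
      have hc := hcon.2 s
      rw [not_or, not_and_not_right] at hc
      have hagree := (agreeExcept_mul_swap (z i) hs).symm.moveTopPair b a
      have e1 := hc.1 hfb
      have e2 := hc.2
      simp only [mulAt, update_self, update_idem] at e1 e2
      exact hE ha (outcome_eq_of_top hagree e2 hcon.1 e1 fun g => not_prefers_moveTopPair _ _ _ _)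
    · exact Or.inl ⟨hfa, ha⟩
  · simp only [Fintype.card_prod, Fintype.card_fin]
    have e5 : q ^ 5 ≤ q ^ 7 := Nat.pow_le_pow_right hq (by norm_num)
    have e2 : q ^ 2 ≤ q ^ 7 := Nat.pow_le_pow_right hq (by norm_num)
    have e4 : q ^ 4 ≤ q ^ 7 := Nat.pow_le_pow_right hq (by norm_num)
    calc _ = (2 * q ^ 5 + q ^ 2 + 2 * q ^ 7 + q ^ 4) * count (IsRManipulationPoint 4 f) := by ring
      _ ≤ _ := Nat.mul_le_mul_right _ (by omega)

/-- Sets of pair edges are nearly independent. -/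
lemma count_isPairEdge_mul_le (f : SCF n q) {i j : Fin n} (hij : i ≠ j)
    {a b c d : Fin q} (hab : a ≠ b) (hcd : c ≠ d) (hac : a ≠ c) (hbc : b ≠ c) (had : a ≠ d)
    (hbd : b ≠ d) :
    count (IsPairEdge f i a b) * count (IsPairEdge f j c d) ≤
      Fintype.card (Profile n q) *
        ((8 * q ^ 7 + 16 * n * q ^ 5) * count (IsRManipulationPoint 4 f)) := by
  set Q := Fintype.card (Profile n q) with hQ
  set μ := count (IsRManipulationPoint 4 f) with hμ
  have hQ0 : 0 < Q := Fintype.card_pos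
  have hE := count_ne_resample_le (IsPairEdge f i a b) a b univ fun k _ p p' hp =>
    count_isPairEdge_mulAt_swap_le f i k hab hp
  have hF := count_ne_resample_le (IsPairEdge f j c d) c d univ fun k _ p p' hp =>
    count_isPairEdge_mulAt_swap_le f j k hcd hp
  rw [card_univ, Fintype.card_fin, ← hQ, ← hμ] at hE hF
  have hI := count_isPairEdge_and_isPairEdge_le f hij hab hcd hac hbc had hbd
  rw [← hμ] at hI
  -- For t = (x, y, r), let w take its order of a, b from x, that of c, d from y, and the rest from
  -- r. Then w is a resampling of x and, as the two operations commute, also one of y. The maps `e₁`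
  -- and `e₂` exhibit w in these two ways, and `e₃ ∘ e₁` has w as first component.
  set e₁ : Profile n q × (Profile n q × Profile n q) → (Profile n q × Profile n q) × Profile n q :=
    fun t => ((t.1, (exchange c d univ t.2).1), (exchange c d univ t.2).2) with he₁
  have he₁_inj : Injective e₁ := by
    rintro ⟨x, t⟩ ⟨x', t'⟩ h
    simp only [he₁, Prod.mk.injEq] at h
    have := exchange_injective c d univ (Prod.ext h.1.2 h.2)
    rw [h.1.1, this]
  set e₂ : Profile n q × (Profile n q × Profile n q) → (Profile n q × Profile n q) × Profile n q :=
    fun t => ((t.2.1, (exchange a b univ (t.1, t.2.2)).1), (exchange a b univ (t.1, t.2.2)).2)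
    with he₂
  have he₂_inj : Injective e₂ := by
    rintro ⟨x, y, r⟩ ⟨x', y', r'⟩ h
    simp only [he₂, Prod.mk.injEq] at h
    have := exchange_injective a b univ (Prod.ext h.1.2 h.2)
    simp only [Prod.mk.injEq] at this
    rw [h.1.1, this.1, this.2]
  set e₃ : (Profile n q × Profile n q) × Profile n q → Profile n q × (Profile n q × Profile n q) :=
    fun t => ((exchange a b univ t.1).1, ((exchange a b univ t.1).2, t.2)) with he₃
  have he₃_inj : Injective e₃ := by
    rintro ⟨x, t⟩ ⟨x', t'⟩ h
    simp only [he₃, Prod.mk.injEq] at h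
    have := exchange_injective a b univ (Prod.ext h.1 h.2.1)
    rw [this, h.2.2]
  have h1 := (count_comp he₁_inj _).trans (count_fst (β := Profile n q)
    (fun p : Profile n q × Profile n q => IsPairEdge f i a b (resample a b univ p.1 p.2) ≠
      IsPairEdge f i a b p.1)).le |>.trans (Nat.mul_le_mul_right _ hE)
  have h2 := (count_comp he₂_inj _).trans (count_fst (β := Profile n q)
    (fun p : Profile n q × Profile n q => IsPairEdge f j c d (resample c d univ p.1 p.2) ≠
      IsPairEdge f j c d p.1)).le |>.trans (Nat.mul_le_mul_right _ hF)
  have h3 := (count_comp (he₃_inj.comp he₁_inj) _).trans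
    (count_fst (β := Profile n q × Profile n q)
      (fun z => IsPairEdge f i a b z ∧ IsPairEdge f j c d z)).le |>.trans
        (Nat.mul_le_mul_right _ hI)
  have hprod := count_prod (IsPairEdge f i a b)
    (fun p : Profile n q × Profile n q => IsPairEdge f j c d p.1)
  rw [count_fst, ← mul_assoc] at hprod
  rw [← hQ] at hprod h1 h2
  have key : count (IsPairEdge f i a b) * count (IsPairEdge f j c d) * Q ≤
      8 * q ^ 7 * μ * (Q * Q) + (n * (2 * (Q * (q ^ 3 * (4 * (q ^ 2 * μ))))) * Q +
        n * (2 * (Q * (q ^ 3 * (4 * (q ^ 2 * μ))))) * Q) := by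
    rw [← hprod]
    rw [Fintype.card_prod, ← hQ] at h3
    refine (count_mono fun t ht => ?_).trans ((count_or _ _).trans (Nat.add_le_add h3
      ((count_or _ _).trans (Nat.add_le_add h1 h2))))
    obtain ⟨x, y, r⟩ := t
    simp only at ht
    have hm : resample a b univ x (resample c d univ y r) =
        resample c d univ y (resample a b univ x r) := by
      funext k
      simp [resample, matchOrder_comm hac.symm hbc.symm had.symm hbd.symm]
    simp only [he₁, he₂, he₃, exchange, comp_apply]
    by_contra hcon
    rw [not_or, not_or, not_not, not_not, ← hm] at hcon
    obtain ⟨hc1, hc2, hc3⟩ := hcon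
    exact hc1 ⟨hc2.symm ▸ ht.1, hc3.symm ▸ ht.2⟩
  refine Nat.le_of_mul_le_mul_right (key.trans (le_of_eq ?_)) hQ0
  ring

lemma count_isBoundary_mul_le (f : SCF n q) {i j : Fin n} (hij : i ≠ j)
    {a b c d : Fin q} (hab : a ≠ b) (hcd : c ≠ d) (hac : a ≠ c) (hbc : b ≠ c) (had : a ≠ d)
    (hbd : b ≠ d) :
    count (IsBoundary f i a b) * count (IsBoundary f j c d) ≤
      Fintype.card (Profile n q) * (36 * n * q ^ 7 * count (IsRManipulationPoint 4 f)) := by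
  have hq : 1 ≤ q := a.pos
  have hn : 1 ≤ n := i.pos
  have hEF := count_isPairEdge_mul_le f hij hab hcd hac hbc had hbd
  have split : ∀ (k : Fin n) (a b : Fin q), count (IsBoundary f k a b) ≤
      count (IsPairEdge f k a b) + 6 * q ^ 7 * count (IsRManipulationPoint 4 f) := fun k a b =>
    (count_mono fun z hz => by
      by_cases h : IsPairEdge f k a b z
      · exact Or.inl h
      · exact Or.inr ⟨hz, h⟩).trans ((count_or _ _).trans
        (Nat.add_le_add_left (count_isBoundary_and_not_isPairEdge_le f k a b) _))
  have h1 := split i a b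
  have h2 := split j c d
  have h3 := count_le_card (IsPairEdge f i a b)
  have h4 := count_le_card (IsBoundary f j c d)
  have e5 : q ^ 5 ≤ q ^ 7 := Nat.pow_le_pow_right hq (by norm_num)
  generalize count (IsRManipulationPoint 4 f) = μ at *
  generalize Fintype.card (Profile n q) = Q at *
  generalize count (IsBoundary f i a b) = B at *
  generalize count (IsBoundary f j c d) = B' at *
  generalize count (IsPairEdge f i a b) = E at *
  generalize count (IsPairEdge f j c d) = E' at *
  calc B * B' ≤ (E + 6 * q ^ 7 * μ) * B' := Nat.mul_le_mul_right _ h1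
    _ = E * B' + 6 * q ^ 7 * μ * B' := by ring
    _ ≤ E * (E' + 6 * q ^ 7 * μ) + 6 * q ^ 7 * μ * Q :=
      Nat.add_le_add (Nat.mul_le_mul_left _ h2) (Nat.mul_le_mul_left _ h4)
    _ = E * E' + E * (6 * q ^ 7 * μ) + 6 * q ^ 7 * μ * Q := by ring
    _ ≤ Q * ((8 * q ^ 7 + 16 * n * q ^ 5) * μ) + Q * (6 * q ^ 7 * μ) + 6 * q ^ 7 * μ * Q := by
      gcongr
    _ = Q * ((20 * 1 * q ^ 7 + 16 * n * q ^ 5) * μ) := by ring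
    _ ≤ Q * ((20 * n * q ^ 7 + 16 * n * q ^ 7) * μ) := by gcongr
    _ = Q * (36 * n * q ^ 7 * μ) := by ring

lemma exists_perm_apply_eq {a b c d : Fin q} (hab : a ≠ b) (hcd : c ≠ d) :
    ∃ y : Equiv.Perm (Fin q), y a = c ∧ y b = d := by
  refine ⟨Equiv.swap (Equiv.swap a c b) d * Equiv.swap a c, ?_, by simp⟩
  rw [Equiv.Perm.mul_apply, Equiv.swap_apply_left, Equiv.swap_apply_of_ne_of_ne _ hcd]
  exact fun h => hab ((Equiv.swap a c).injective (by rwa [Equiv.swap_apply_left]))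

/-- Renaming alternatives acts on the left and commutes with exchanging positions, which acts on the
right. -/
lemma IsNeutral.count_isBoundary_le {f : SCF n q} (hf : IsNeutral f) (k : Fin n)
    {a b c d : Fin q} (hab : a ≠ b) (hcd : c ≠ d) :
    count (IsBoundary f k a b) ≤ count (IsBoundary f k c d) := by
  obtain ⟨y, rfl, rfl⟩ := exists_perm_apply_eq hab hcd
  have hinj : Injective fun (z : Profile n q) i => y * z i := fun z z' h => by
    funext i
    exact mul_left_cancel (congrFun h i)
  refine (count_mono fun z hz => ?_).trans (count_comp hinj _)
  obtain ⟨s, hs, rfl, rfl⟩ := hz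
  refine ⟨s, hs, (hf _ _).symm, ?_⟩
  rw [hf]
  congr 1
  funext i
  by_cases hi : i = k
  · subst hi
    simp [mulAt, mul_assoc]
  · simp [mulAt, hi]

lemma IsNeutral.count_mulAt_swap_ne_le {f : SCF n q} (hf : IsNeutral f) (k : Fin n)
    {a b : Fin q} (hab : a ≠ b) {p p' : Fin q} (hp : (p' : ℕ) = p + 1) :
    count (fun z => f (mulAt k (Equiv.swap p p') z) ≠ f z) ≤
      q ^ 2 * count (IsBoundary f k a b) := by
  have := count_exists_le (fun (s : Fin q × Fin q) (z : Profile n q) =>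
      s.1 ≠ s.2 ∧ IsBoundary f k s.1 s.2 z) (C := count (IsBoundary f k a b)) fun s => by
    by_cases hs : s.1 = s.2
    · simp [hs, count]
    · exact (count_mono fun z hz => hz.2).trans (hf.count_isBoundary_le k hs hab)
  refine (count_mono fun z hz => ?_).trans (this.trans (le_of_eq (by simp [sq])))
  exact ⟨(f z, _), hz.symm, (p, p'), hp, rfl, rfl⟩

end Boundaries

/-! ### From distance to dictators to large boundaries -/

section Distance

variable {n q : ℕ}

lemma prob_eq (P : Profile n q → Prop) :
    prob P = count P / Fintype.card (Profile n q) := by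
  rw [prob, nat_card_subtype_eq_count, Nat.card_eq_fintype_card]

lemma dist_nonneg (f g : SCF n q) : 0 ≤ dist f g := by
  rw [dist, prob_eq]
  positivity

lemma distClass_le {f g : SCF n q} {G : Set (SCF n q)} (hg : g ∈ G) : distClass f G ≤ dist f g :=
  csInf_le ⟨0, by rintro _ ⟨g, -, rfl⟩; exact dist_nonneg f g⟩ ⟨g, hg, rfl⟩

/-- A neutral function that is far from being determined by voter `i` has a large boundary in some
other direction. -/
lemma IsNeutral.exists_le_count_isBoundary {f : SCF n q} (hf : IsNeutral f) {ε : ℝ} (hε : 0 < ε)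
    (hdist : ε ≤ distClass f (DICT n q)) (i : Fin n) {a b : Fin q} (hab : a ≠ b) :
    ∃ k ≠ i, ε * Fintype.card (Profile n q) ≤ 2 * n * q ^ 5 * count (IsBoundary f k a b) := by
  classical
  set Q := Fintype.card (Profile n q) with hQ
  have hQ0 : (0 : ℝ) < Q := by exact_mod_cast Fintype.card_pos
  -- Keeping the order of a and a is no constraint, so every coordinate but i is replaced by that of
  -- r. For fixed r the result depends only on coordinate i, so it differs from f on a fraction at
  -- least ε of the profiles.
  have hlow : ε * Q * Q ≤ count (fun p : Profile n q × Profile n q =>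
      f (resample a a (univ.erase i) p.1 p.2) ≠ f p.1) := by
    rw [count_prod_eq_sum]
    push_cast
    have : ∀ r : Profile n q, ε * Q ≤
        count (fun x => f (resample a a (univ.erase i) x r) ≠ f x) := fun r => by
      have hg : (fun x => f (resample a a (univ.erase i) x r)) ∈ DICT n q := by
        refine Set.mem_iUnion.2 ⟨i, fun x y hxy => ?_⟩
        simp only
        congr 1
        funext k
        by_cases hk : k = i
        · subst hk
          simpa [resample] using hxy k rfl
        · simp [resample, hk, matchOrder_self]
      have := hdist.trans (distClass_le (f := f) hg)
      rw [dist, prob_eq, le_div_iff₀ hQ0] at this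
      simpa [ne_comm] using this
    refine le_trans (le_of_eq ?_) (sum_le_sum fun r _ => this r)
    simp [← hQ]
    ring
  have hne : (univ.erase i : Finset (Fin n)).Nonempty := by
    by_contra hcon
    rw [not_nonempty_iff_eq_empty] at hcon
    have := count_ne_resample_le f a a (N := 0) (univ.erase i) (by simp [hcon])
    rw [hcon, card_empty, zero_mul, Nat.le_zero, ← hcon] at this
    rw [this] at hlow
    have : 0 < ε * Q * Q := by positivity
    simp only [Nat.cast_zero] at hlow
    linarith
  -- The direction with the largest boundary carries at least the average over the resampled
  -- coordinates.
  obtain ⟨k, hk, hmax⟩ := exists_max_image _ (fun k => count (IsBoundary f k a b)) hne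
  refine ⟨k, ne_of_mem_erase hk, ?_⟩
  have hup := count_ne_resample_le f a a (univ.erase i)
    (N := q ^ 2 * count (IsBoundary f k a b)) fun j hj p p' hp =>
      (count_mono fun z hz => hz.2.2).trans ((hf.count_mulAt_swap_ne_le j hab hp).trans
        (Nat.mul_le_mul_left _ (hmax j hj)))
  have hcard : (univ.erase i : Finset (Fin n)).card ≤ n := by
    simp
  have hup' := hup.trans (Nat.mul_le_mul_right _ hcard)
  rw [← hQ] at hup'
  have hreal : ε * Q * Q ≤ (n * (2 * (Q * (q ^ 3 * (q ^ 2 * count (IsBoundary f k a b))))) : ℝ) :=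
    hlow.trans (by exact_mod_cast hup')
  refine le_of_mul_le_mul_right (hreal.trans (le_of_eq ?_)) hQ0
  ring

end Distance

end SocialChoice

/-! ### The main theorem -/

theorem theorem3 (n q : ℕ) (hq : 4 ≤ q) (f : SocialChoice.SCF n q)
    (hf : SocialChoice.IsNeutral f) (ε : ℝ) (hε : 0 ≤ ε)
    (hdist : ε ≤ SocialChoice.distClass f (SocialChoice.DICT n q)) :
    SocialChoice.prob (fun X => SocialChoice.IsRManipulationPoint 4 f X) ≤
        SocialChoice.prob (fun X => SocialChoice.IsManipulationPoint f X) ∧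
      ε ^ 2 / (10 ^ 4 * (n : ℝ) ^ 3 * (q : ℝ) ^ 30) ≤
        SocialChoice.prob (fun X => SocialChoice.IsRManipulationPoint 4 f X) := by
  open SocialChoice in
  have hQ0 : (0 : ℝ) < Fintype.card (Profile n q) := by exact_mod_cast Fintype.card_pos
  refine ⟨?_, ?_⟩
  · rw [prob_eq, prob_eq]
    gcongr
    exact count_mono fun x ⟨y, hy, _⟩ => ⟨y, hy⟩
  rw [prob_eq, le_div_iff₀ hQ0]
  rcases hε.eq_or_lt with rfl | hε
  · simp
  -- For n = 0 the bound is a division by zero, hence 0.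
  rcases Nat.eq_zero_or_pos n with rfl | hn
  · simp
  -- Voter 0 is an arbitrary choice to obtain j; avoiding j then yields i ≠ j.
  obtain ⟨j, -, hj⟩ := hf.exists_le_count_isBoundary hε hdist ⟨0, hn⟩
    (a := ⟨2, by omega⟩) (b := ⟨3, by omega⟩) (by simp)
  obtain ⟨i, hij, hi⟩ := hf.exists_le_count_isBoundary hε hdist j
    (a := ⟨0, by omega⟩) (b := ⟨1, by omega⟩) (by simp)
  have hmul := count_isBoundary_mul_le f hij (a := ⟨0, by omega⟩) (b := ⟨1, by omega⟩)
    (c := ⟨2, by omega⟩) (d := ⟨3, by omega⟩) (by simp) (by simp) (by simp) (by simp) (by simp)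
    (by simp)
  have hmul' : (count (IsBoundary f i ⟨0, by omega⟩ ⟨1, by omega⟩) : ℝ) *
      count (IsBoundary f j ⟨2, by omega⟩ ⟨3, by omega⟩) ≤
      Fintype.card (Profile n q) * (36 * n * q ^ 7 * count (IsRManipulationPoint 4 f)) := by
    exact_mod_cast hmul
  have hn' : (0 : ℝ) < n := by exact_mod_cast hn
  have hq' : (1 : ℝ) ≤ q := by exact_mod_cast (by omega : 1 ≤ q)
  change _ ≤ (count (IsRManipulationPoint 4 f) : ℝ)
  generalize (count (IsRManipulationPoint 4 f) : ℝ) = μ at *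
  generalize (Fintype.card (Profile n q) : ℝ) = Q at *
  generalize (count (IsBoundary f i _ _) : ℝ) = B at *
  generalize (count (IsBoundary f j _ _) : ℝ) = B' at *
  have h1 : (ε * Q) * (ε * Q) ≤ (2 * n * q ^ 5 * B) * (2 * n * q ^ 5 * B') :=
    mul_le_mul hi hj (by positivity) ((by positivity : 0 ≤ ε * Q).trans hi)
  -- 144 n³ q¹⁷ is (2 n q⁵)² from the two boundaries times 36 n q⁷ from their product.
  have h2 : (ε ^ 2 * Q) * Q ≤ (144 * n ^ 3 * q ^ 17 * μ) * Q := by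
    calc (ε ^ 2 * Q) * Q = (ε * Q) * (ε * Q) := by ring
      _ ≤ 4 * n ^ 2 * q ^ 10 * (B * B') := h1.trans (le_of_eq (by ring))
      _ ≤ 4 * n ^ 2 * q ^ 10 * (Q * (36 * n * q ^ 7 * μ)) := by gcongr
      _ = _ := by ring
  have h3 : ε ^ 2 * Q ≤ 144 * n ^ 3 * q ^ 17 * μ := le_of_mul_le_mul_right h2 hQ0
  have hμ : 0 ≤ μ := by
    by_contra! hneg
    have : 144 * (n : ℝ) ^ 3 * q ^ 17 * μ < 0 := mul_neg_of_pos_of_neg (by positivity) hneg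
    have : 0 < ε ^ 2 * Q := by positivity
    linarith
  rw [div_mul_eq_mul_div, div_le_iff₀ (by positivity)]
  refine h3.trans ?_
  calc 144 * (n : ℝ) ^ 3 * q ^ 17 * μ ≤ 10 ^ 4 * n ^ 3 * q ^ 30 * μ := by
        gcongr <;> norm_num
    _ = μ * (10 ^ 4 * n ^ 3 * q ^ 30) := by ring
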